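/- All algebraic groups are over $\mathbb{C}$. A linear algebraic group is a Zariski closed subgroup $G$ of some $GL_N(\mathbb{C})$. Its commuting probability is $$p(G)=\frac{\dim C(G)}{\dim (G\times G)}=\frac{\dim C(G)}{2\dim G},\qquad C(G)=\{(x,y)\in G\times G : xy=yx\},$$ if $\dim G>0$, and $p(G)=1$ if $\dim G=0$. A reductive group is a connected linear algebraic group whose only connected closed normal unipotent subgroup is the trivial one. **Proposition.** For every rational number $r\in(\frac12,1]$ there is a reductive group $G$ with $p(G)=r$. Explicitly, let $p\ge 0$ and $q>0$ be integers with $\frac12<\frac pq\le 1$. Then there is an integer $n\ge 2$ with $\frac{n+1}{2n}\le \frac pq$. For every integer $n\ge 1$ with $\frac{n+1}{2n}\le\frac pq$, the numbers $$a=q-p,\qquad b=\frac{2n^2p-n^2q-nq}{2}$$ are non-negative integers, the group $G=GL_n^a\times\mathbb{G}_m^b$ is reductive, and $p(G)=\frac pq$. -/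

import Mathlib

noncomputable section

open MvPolynomial

/-- The Zariski topology on the affine space `ℂ^σ`: the closed sets are the zero loci of ideals of
the polynomial ring. -/
@[reducible] def affineZariski (σ : Type) : TopologicalSpace (σ → ℂ) :=
  TopologicalSpace.ofClosed {S | ∃ I : Ideal (MvPolynomial σ ℂ), S = zeroLocus ℂ I}
    ⟨⊤, zeroLocus_top.symm⟩
    (by
      intro A hA
      refine ⟨vanishingIdeal ℂ (⋂₀ A), ?_⟩
      refine Set.Subset.antisymm (zeroLocus_vanishingIdeal_le _) (Set.subset_sInter fun S hS => ?_)
      obtain ⟨I, rfl⟩ := hA hS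
      exact zeroLocus_anti_mono (le_zeroLocus_iff_le_vanishingIdeal.mp (Set.sInter_subset_of_mem hS)))
    (by
      rintro _ ⟨I, rfl⟩ _ ⟨J, rfl⟩
      refine ⟨I ⊓ J, Set.Subset.antisymm (Set.union_subset (zeroLocus_anti_mono inf_le_left)
        (zeroLocus_anti_mono inf_le_right)) fun x h => ?_⟩
      by_contra hc
      obtain ⟨hI, hJ⟩ := not_or.mp hc
      refine hI (mem_zeroLocus_iff.mpr fun p hp => ?_)
      by_contra hp0
      refine hJ (mem_zeroLocus_iff.mpr fun q hq => ?_)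
      have hpq : aeval x (p * q) = (0 : ℂ) :=
        mem_zeroLocus_iff.mp h (p * q) ⟨I.mul_mem_right q hp, J.mul_mem_left p hq⟩
      rw [map_mul] at hpq
      exact (mul_eq_zero.mp hpq).resolve_left hp0)

/-- The affine space in which `GL_ι(ℂ)` is a closed subset has one coordinate for each matrix
entry and one more for the inverse of the determinant. -/
abbrev GLIndex (ι : Type) : Type := (ι × ι) ⊕ Unit

section

variable {ι : Type} [Fintype ι] [DecidableEq ι]

/-- The closed embedding `g ↦ (g, (det g)⁻¹)` of `GL_ι(ℂ)` into affine space. -/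
def glCoord (g : GL ι ℂ) : GLIndex ι → ℂ :=
  Sum.elim (fun ij => (g : Matrix ι ι ℂ) ij.1 ij.2) (fun _ => ((g : Matrix ι ι ℂ).det)⁻¹)

/-- The product embedding of `GL_ι(ℂ) × GL_ι(ℂ)` into affine space. -/
def glPairCoord (x : GL ι ℂ × GL ι ℂ) : GLIndex ι ⊕ GLIndex ι → ℂ :=
  Sum.elim (glCoord x.1) (glCoord x.2)

variable (ι) in
/-- The Zariski topology on `GL_ι(ℂ)`: the closed sets are the sets of common zeros of
polynomials in the matrix entries and the inverse of the determinant. -/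
@[reducible] def glZariski : TopologicalSpace (GL ι ℂ) :=
  (affineZariski (GLIndex ι)).induced glCoord

end

/-- The dimension of a subset `V` of affine space `ℂ^σ`, that is, the Krull dimension of its
coordinate ring `ℂ[σ] / I(V)`. (For finite `σ` and non-empty `V` that Krull dimension is a natural
number, so nothing is lost in the conversion to `ℕ`.) -/
def affineDim {σ : Type} (V : Set (σ → ℂ)) : ℕ :=
  ((ringKrullDim (MvPolynomial σ ℂ ⧸ vanishingIdeal ℂ V)).unbotD 0).toNat

section

variable {ι : Type} [Fintype ι] [DecidableEq ι]

/-- A linear algebraic group over `ℂ`: a Zariski closed subgroup of `GL_ι(ℂ)`. -/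
def IsLinearAlgebraic (G : Subgroup (GL ι ℂ)) : Prop :=
  @IsClosed (GL ι ℂ) (glZariski ι) (G : Set (GL ι ℂ))

/-- Connectedness in the Zariski topology. -/
def IsZariskiConnected (G : Subgroup (GL ι ℂ)) : Prop :=
  @IsConnected (GL ι ℂ) (glZariski ι) (G : Set (GL ι ℂ))

/-- All elements of `U` are unipotent. -/
def IsUnipotentGroup (U : Subgroup (GL ι ℂ)) : Prop :=
  ∀ u ∈ U, IsNilpotent ((u : Matrix ι ι ℂ) - 1)

/-- A (connected) reductive group: a connected linear algebraic group whose unipotent radical is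
trivial, i.e. whose only connected closed normal unipotent subgroup is the trivial one. -/
structure IsReductive (G : Subgroup (GL ι ℂ)) : Prop where
  linearAlgebraic : IsLinearAlgebraic G
  connected : IsZariskiConnected G
  unipotentRadical : ∀ U : Subgroup (GL ι ℂ), U ≤ G → (U.subgroupOf G).Normal →
    IsLinearAlgebraic U → IsZariskiConnected U → IsUnipotentGroup U → U = ⊥

/-- The dimension of `G`. -/
def groupDim (G : Subgroup (GL ι ℂ)) : ℕ :=
  affineDim (glCoord '' (G : Set (GL ι ℂ)))

/-- The set `C(G)` of ordered pairs of commuting elements of `G`. -/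
def commutingPairs (G : Subgroup (GL ι ℂ)) : Set (GL ι ℂ × GL ι ℂ) :=
  {x | x.1 ∈ G ∧ x.2 ∈ G ∧ x.1 * x.2 = x.2 * x.1}

/-- The commuting probability `p(G) = dim C(G) / (2 dim G)`, and `p(G) = 1` if `dim G = 0`. -/
def algCommProb (G : Subgroup (GL ι ℂ)) : ℚ :=
  if groupDim G = 0 then 1
  else (affineDim (glPairCoord '' commutingPairs G) : ℚ) / (2 * (groupDim G : ℚ))

end

/-- The block diagonal embedding of the direct product `GL_n(ℂ)^a × (ℂˣ)^b`, with `a` blocks of size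
`n` and `b` blocks of size `1`, into the general linear group of size `n * a + b`. -/
def glPowTorusHom (n a b : ℕ) :
    (Fin a → GL (Fin n) ℂ) × (Fin b → ℂˣ) →* GL ((Fin n × Fin a) ⊕ Fin b) ℂ :=
  MonoidHom.toHomUnits
    { toFun := fun g => Matrix.fromBlocks
        (Matrix.blockDiagonal fun i => (g.1 i : Matrix (Fin n) (Fin n) ℂ)) 0
        0 (Matrix.diagonal fun j => (g.2 j : ℂ))
      map_one' := by
        have h : (Matrix.blockDiagonal fun _ : Fin a => (1 : Matrix (Fin n) (Fin n) ℂ)) = 1 :=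
          Matrix.blockDiagonal_one
        simp [h]
      map_mul' := by
        intro g h
        simp [Matrix.fromBlocks_multiply, Matrix.blockDiagonal_mul] }

/-- The linear algebraic group `GL_n^a × 𝔾_m^b`, as a group of block diagonal matrices. -/
def glPowTorus (n a b : ℕ) : Subgroup (GL ((Fin n × Fin a) ⊕ Fin b) ℂ) :=
  (glPowTorusHom n a b).range

end

noncomputable section

section

open MvPolynomial

/-! ### Krull dimension of finitely generated algebras -/

/-! For `G = GL_n^a × 𝔾_m^b` one has `dim G = a n² + b` and `dim C(G) = a (n² + n) + 2b`. With `a =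
q - p` and the stated `b` this gives `2 dim G = n(n-1)q` and `dim C(G) = n(n-1)p`, so the quotient
is `p/q`.

The substance is `dim C(GL_n) = n² + n`, in the spirit of Motzkin and Taussky. The map `(A, c) ↦ (A,
c(A))`, with `c` a polynomial of degree `< n`, sends `n² + n` parameters to commuting pairs. Its
image is dense: any `B` commutes with some `R` having a cyclic vector (`exists_commute_cyclic`). If
`A` commutes with `B`, so does the whole line from `A` to `R`; its points near `A`, other than `A`,
are cyclic, so `B` is a polynomial in each of them. Conversely, when `e₀` is cyclic for `A`, the
first column of `c(A)` determines `c` and is arbitrary, so `A` and this column give `n² + n`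
algebraically independent coordinates.

`affineDim_eq_card` turns these two facts into a Krull dimension: a dense rational parametrization
bounds it above, independent coordinates bound it below. Density is proved in the Euclidean
topology, where limits are available; zero sets of polynomials are closed there too.

Reductivity: `G` is the image of the complement of a hypersurface, hence connected. A normal
unipotent subgroup is trivial by a trace computation with conjugates by transvections. -/

theorem ringKrullDim_eq_of_isIntegral {R S : Type*} [CommRing R] [CommRing S] [Algebra R S]
    [Algebra.IsIntegral R S] (h : Function.Injective (algebraMap R S)) :
    ringKrullDim S = ringKrullDim R := by
  refine le_antisymm ?_ ?_
  · refine Order.krullDim_le_of_strictMono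
      (PrimeSpectrum.comap (algebraMap R S)) fun P Q hPQ => ?_
    exact Ideal.IsIntegral.comap_lt_comap (I := P.asIdeal) (J := Q.asIdeal) hPQ
  · refine iSup_le fun l => ?_
    obtain ⟨P, -, hP, hcomap⟩ := Ideal.exists_ideal_over_prime_of_isIntegral (S := S)
      l.head.asIdeal ⊥ (by
        rw [← RingHom.ker_eq_comap_bot, (RingHom.injective_iff_ker_eq_bot _).mp h]
        exact bot_le)
    have : P.LiesOver l.head.asIdeal := ⟨hcomap.symm⟩
    obtain ⟨L, hL, -, -⟩ := Ideal.exists_ltSeries_of_hasGoingUp l P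
    rw [← hL]
    exact le_iSup (fun L : LTSeries (PrimeSpectrum S) => (L.length : WithBot ℕ∞)) L

/-- Some minimal prime of `R` contracts to `0` in the polynomial ring, which reduces the claim to a
domain. There Noether normalization identifies Krull dimension with transcendence degree, which is
monotone under embeddings. -/
theorem card_le_ringKrullDim_of_injective {k R τ : Type} [Field k] [CommRing R] [Algebra k R]
    [Algebra.FiniteType k R] [Fintype τ] (g : MvPolynomial τ k →ₐ[k] R)
    (hg : Function.Injective g) : (Fintype.card τ : WithBot ℕ∞) ≤ ringKrullDim R := by
  obtain ⟨P, hP, hPg⟩ := Ideal.exists_comap_eq_of_mem_minimalPrimes_of_injective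
    (f := g.toRingHom) hg ⊥ (by rw [IsDomain.minimalPrimes_eq_singleton_bot]; rfl)
  have hinj : Function.Injective ((Ideal.Quotient.mkₐ k P).comp g) := by
    rw [injective_iff_map_eq_zero]
    intro a ha
    have h : g a ∈ P := Ideal.Quotient.eq_zero_iff_mem.mp ha
    have h' : a ∈ P.comap g.toRingHom := h
    rwa [hPg] at h'
  obtain ⟨s, f, hf, hfint⟩ := exists_integral_inj_algHom_of_fg k (R ⧸ P)
  algebraize [f.toRingHom]
  have : Algebra.IsIntegral (MvPolynomial (Fin s) k) (R ⧸ P) := ⟨hfint⟩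
  have : FaithfulSMul (MvPolynomial (Fin s) k) (R ⧸ P) :=
    (faithfulSMul_iff_algebraMap_injective _ _).mpr hf
  have : IsScalarTower k (MvPolynomial (Fin s) k) (R ⧸ P) :=
    IsScalarTower.of_algebraMap_eq fun x => (f.commutes x).symm
  have hdim : ringKrullDim (R ⧸ P) = s := by
    rw [ringKrullDim_eq_of_isIntegral (R := MvPolynomial (Fin s) k) hf]
    simp
  have htr : Algebra.trdeg k (R ⧸ P) = s := by
    rw [← trdeg_add_eq k (MvPolynomial (Fin s) k) (A := R ⧸ P),
      trdeg_eq_zero (R := MvPolynomial (Fin s) k)]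
    simp
  have hle := trdeg_le_of_injective _ hinj
  rw [htr, MvPolynomial.trdeg_of_isDomain] at hle
  have hle' : Fintype.card τ ≤ s := by simpa using hle
  calc (Fintype.card τ : WithBot ℕ∞) ≤ s := by exact_mod_cast hle'
    _ = ringKrullDim (R ⧸ P) := hdim.symm
    _ ≤ ringKrullDim R := ringKrullDim_quotient_le P

/-- A Noether normalization of `R` is a polynomial ring of the same dimension, and it embeds into a
field of transcendence degree `Fintype.card τ`. -/
theorem ringKrullDim_le_of_injective_fractionRing {k R τ : Type} [Field k] [CommRing R]
    [Algebra k R] [Algebra.FiniteType k R] [Fintype τ]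
    (f : R →ₐ[k] FractionRing (MvPolynomial τ k)) (hf : Function.Injective f) :
    ringKrullDim R ≤ Fintype.card τ := by
  have : Nontrivial R := f.toRingHom.domain_nontrivial
  obtain ⟨s, g, hg, hgint⟩ := exists_integral_inj_algHom_of_fg k R
  algebraize [g.toRingHom]
  have : Algebra.IsIntegral (MvPolynomial (Fin s) k) R := ⟨hgint⟩
  have : Algebra.IsAlgebraic (MvPolynomial τ k) (FractionRing (MvPolynomial τ k)) :=
    IsLocalization.isAlgebraic _ (nonZeroDivisors _)
  have htr : Algebra.trdeg k (FractionRing (MvPolynomial τ k)) = Fintype.card τ := by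
    rw [← trdeg_add_eq k (MvPolynomial τ k) (A := FractionRing (MvPolynomial τ k)),
      trdeg_eq_zero (R := MvPolynomial τ k)]
    simp
  have hle := trdeg_le_of_injective (f.comp g) (hf.comp hg)
  rw [htr, MvPolynomial.trdeg_of_isDomain] at hle
  have hle' : s ≤ Fintype.card τ := by simpa using hle
  rw [ringKrullDim_eq_of_isIntegral (R := MvPolynomial (Fin s) k) hg]
  simpa using by exact_mod_cast hle'

/-! ### Dimension of rationally parametrized sets -/

theorem continuous_aeval_mvPolynomial {σ : Type} (p : MvPolynomial σ ℂ) :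
    Continuous fun w : σ → ℂ => aeval w p := by
  exact MvPolynomial.continuous_eval p

theorem mvPolynomial_eq_zero_of_eval_eq_zero {τ : Type} {P D : MvPolynomial τ ℂ} (hD : D ≠ 0)
    (h : ∀ t, eval t D ≠ 0 → eval t P = 0) : P = 0 := by
  have : P * D = 0 := MvPolynomial.funext fun t => by
    by_cases ht : eval t D = 0
    · simp [ht]
    · simp [h t ht]
  exact (mul_eq_zero.mp this).resolve_right hD

theorem eval_comp_X {τ : Type} (t : τ → ℂ) : eval t ∘ (X : τ → MvPolynomial τ ℂ) = t := by
  ext x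
  simp

theorem eval_comp_X_comp {τ τ' : Type} (t : τ → ℂ) (f : τ' → τ) :
    eval t ∘ ((X : τ → MvPolynomial τ ℂ) ∘ f) = t ∘ f := by
  rw [← Function.comp_assoc, eval_comp_X]

/-- Clearing denominators when the coordinates `ψ s / D` are substituted in a polynomial. -/
theorem exists_clear_denominators {σ τ : Type} (D : MvPolynomial τ ℂ) (hD : D ≠ 0)
    (ψ : σ → MvPolynomial τ ℂ) (p : MvPolynomial σ ℂ) :
    ∃ (N : ℕ) (q : MvPolynomial τ ℂ),
      algebraMap _ (FractionRing (MvPolynomial τ ℂ)) D ^ N *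
        aeval (fun s => algebraMap _ (FractionRing (MvPolynomial τ ℂ)) (ψ s) /
          algebraMap _ (FractionRing (MvPolynomial τ ℂ)) D) p = algebraMap _ _ q ∧
      ∀ (t : τ → ℂ) (w : σ → ℂ), (∀ s, eval t D * w s = eval t (ψ s)) →
        eval t D ^ N * aeval w p = eval t q := by
  have hD' : algebraMap _ (FractionRing (MvPolynomial τ ℂ)) D ≠ 0 := by
    simpa using hD
  induction p using MvPolynomial.induction_on with
  | C a =>
    refine ⟨0, C a, ?_, fun t w _ => by simp⟩
    simp [IsScalarTower.algebraMap_apply ℂ (MvPolynomial τ ℂ) (FractionRing (MvPolynomial τ ℂ)),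
      MvPolynomial.algebraMap_eq]
  | add p q hp hq =>
    obtain ⟨N, a, ha, ha'⟩ := hp
    obtain ⟨M, b, hb, hb'⟩ := hq
    refine ⟨N + M, D ^ M * a + D ^ N * b, ?_, fun t w h => ?_⟩
    · simp only [map_add, map_mul, map_pow, ← ha, ← hb]
      ring
    · simp only [map_add, map_mul, map_pow, ← ha' t w h, ← hb' t w h]
      ring
  | mul_X p s hp =>
    obtain ⟨N, a, ha, ha'⟩ := hp
    refine ⟨N + 1, a * ψ s, ?_, fun t w h => ?_⟩
    · simp only [map_mul, ← ha, aeval_X]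
      field_simp
      ring
    · simp only [map_mul, ← ha' t w h, ← h s, aeval_X]
      ring

/-- Let `V` be contained in the Euclidean closure of the image of a rational map from the affine
space `ℂ^τ`, and suppose that some coordinates, indexed by `τ`, satisfy no polynomial relation on
`V`. Then `V` has the dimension of `ℂ^τ`. -/
theorem affineDim_eq_card {σ τ : Type} [Fintype σ] [Fintype τ] (V : Set (σ → ℂ))
    (D : MvPolynomial τ ℂ) (hD : D ≠ 0) (ψ : σ → MvPolynomial τ ℂ)
    (hV : ∀ v ∈ V, v ∈ closure {w : σ → ℂ | ∃ t, eval t D ≠ 0 ∧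
      ∀ s, eval t D * w s = eval t (ψ s)})
    (e : τ → σ) (he : ∀ P : MvPolynomial τ ℂ, (∀ v ∈ V, eval (v ∘ e) P = 0) → P = 0) :
    affineDim V = Fintype.card τ := by
  set I := vanishingIdeal ℂ V
  have hlow : (Fintype.card τ : WithBot ℕ∞) ≤ ringKrullDim (MvPolynomial σ ℂ ⧸ I) := by
    refine card_le_ringKrullDim_of_injective ((Ideal.Quotient.mkₐ ℂ I).comp (rename e)) ?_
    rw [injective_iff_map_eq_zero]
    refine fun P hP => he P fun v hv => ?_
    have : rename e P ∈ I := Ideal.Quotient.eq_zero_iff_mem.mp hP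
    have h := this v hv
    rwa [aeval_rename, ← coe_aeval_eq_eval] at *
  have hup : ringKrullDim (MvPolynomial σ ℂ ⧸ I) ≤ Fintype.card τ := by
    set φ : MvPolynomial σ ℂ →ₐ[ℂ] FractionRing (MvPolynomial τ ℂ) :=
      aeval fun s => algebraMap _ (FractionRing (MvPolynomial τ ℂ)) (ψ s) /
        algebraMap _ (FractionRing (MvPolynomial τ ℂ)) D with hφ
    -- A polynomial killed by the substitution vanishes on the image of the rational map, hence on
    -- its closure and on `V`. So the coordinate ring of `V` is a quotient of a subring of the
    -- fraction field.
    have hker : RingHom.ker φ ≤ I := by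
      intro p hp v hv
      have hclosed : IsClosed {w : σ → ℂ | aeval w p = 0} :=
        isClosed_eq (continuous_aeval_mvPolynomial p) continuous_const
      refine closure_minimal ?_ hclosed (hV v hv)
      rintro w ⟨t, ht, hw⟩
      obtain ⟨N, q, hq, hq'⟩ := exists_clear_denominators D hD ψ p
      have hq0 : q = 0 := by
        rw [← hφ, RingHom.mem_ker.mp hp, mul_zero] at hq
        simpa using hq.symm
      have := hq' t w hw
      rw [hq0, map_zero] at this
      exact (mul_eq_zero.mp this).resolve_left (pow_ne_zero _ ht)
    refine (ringKrullDim_le_of_surjective (Ideal.Quotient.factor hker)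
      (Ideal.Quotient.factor_surjective hker)).trans ?_
    exact ringKrullDim_le_of_injective_fractionRing (Ideal.kerLiftAlg φ)
      (Ideal.kerLiftAlg_injective φ)
  rw [affineDim, le_antisymm hup hlow]
  rfl

end

/-! ### Cyclic endomorphisms commuting with a given one -/

section

open Polynomial

/-- The substitutions `X ↦ X + cᵢ` separate the quotients by powers of `X - λᵢ` as soon as the
numbers `λᵢ + cᵢ` are distinct. -/
theorem aeval_shift_surjective {κ : Type} [Finite κ] (root c : κ → ℂ) (e : κ → ℕ)
    (h : Function.Injective fun i => root i + c i) :
    Function.Surjective (aeval (R := ℂ) (fun i => Ideal.Quotient.mk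
      (Ideal.span {(X - C (root i)) ^ e i}) (X + C (c i)) :
        ∀ i, ℂ[X] ⧸ Ideal.span {(X - C (root i)) ^ e i})) := by
  intro y
  choose f hf using fun i => Ideal.Quotient.mk_surjective (y i)
  have hcop : Pairwise (Function.onFun IsCoprime
      fun i => Ideal.span {(X - C (root i + c i)) ^ e i}) := by
    intro i j hij
    refine Ideal.isCoprime_span_singleton_iff _ _ |>.mpr ?_
    exact (pairwise_coprime_X_sub_C h hij).pow
  -- Chinese remainder theorem for the shifted moduli; shifting back by `X ↦ X + cᵢ` returns to the
  -- original ones.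
  obtain ⟨g, hg⟩ := Ideal.exists_forall_sub_mem_ideal hcop fun i => (f i).comp (X - C (c i))
  refine ⟨g, funext fun i => ?_⟩
  have h1 : (aeval (R := ℂ) (fun i => Ideal.Quotient.mk
      (Ideal.span {(X - C (root i)) ^ e i}) (X + C (c i)) :
        ∀ i, ℂ[X] ⧸ Ideal.span {(X - C (root i)) ^ e i}) g) i =
      Ideal.Quotient.mk _ (g.comp (X + C (c i))) := by
    rw [comp_eq_aeval]
    exact ((aeval_algHom_apply (Pi.evalAlgHom ℂ _ i) _ g).symm).trans
      (aeval_algHom_apply (Ideal.Quotient.mkₐ ℂ _) _ _)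
  rw [h1, ← hf i, Ideal.Quotient.mk_eq_mk_iff_sub_mem, Ideal.mem_span_singleton]
  obtain ⟨q, hq⟩ := Ideal.mem_span_singleton.mp (hg i)
  refine ⟨q.comp (X + C (c i)), ?_⟩
  have := congrArg (fun p : ℂ[X] => p.comp (X + C (c i))) hq
  simpa [comp_assoc, sub_comp, mul_comp, add_sub_add_right_eq_sub] using this

/-- The structure theorem makes `V` a product of rings `ℂ[X]/(X - λᵢ)^eᵢ` on which `φ` is
multiplication by `X`. Shifting the eigenvalue of each factor to distinct values `μᵢ` gives another
multiplication operator, which commutes with `φ` and for which `1` is cyclic. -/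
theorem exists_commute_cyclic {V : Type} [AddCommGroup V] [Module ℂ V] [FiniteDimensional ℂ V]
    (φ : Module.End ℂ V) :
    ∃ (ρ : Module.End ℂ V) (v : V), Commute ρ φ ∧ ∀ w, ∃ g : ℂ[X], aeval ρ g v = w := by
  obtain ⟨κ, _, p, hp, e, ⟨E⟩⟩ := Module.equiv_directSum_of_isTorsion
    (R := ℂ[X]) (M := Module.AEval' φ) (Module.AEval.isTorsion_of_finiteDimensional ℂ V φ)
  have hroot : ∀ i, ∃ z, Associated (p i) (X - C z) := fun i => by
    obtain ⟨z, hz⟩ := IsAlgClosed.exists_root (p i) (degree_pos_of_irreducible (hp i)).ne'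
    exact ⟨z, ((irreducible_X_sub_C z).associated_of_dvd (hp i) (dvd_iff_isRoot.mpr hz)).symm⟩
  choose root hroot using hroot
  have hspan : ∀ i, Submodule.span ℂ[X] {p i ^ e i} = Ideal.span {(X - C (root i)) ^ e i} :=
    fun i => Ideal.span_singleton_eq_span_singleton.mpr ((hroot i).pow_pow)
  let F : Module.AEval' φ ≃ₗ[ℂ[X]] ∀ i, ℂ[X] ⧸ Ideal.span {(X - C (root i)) ^ e i} :=
    (E.trans (DirectSum.linearEquivFunOnFintype ℂ[X] κ _)).trans
      (LinearEquiv.piCongrRight fun i => Submodule.quotEquivOfEq _ _ (hspan i))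
  let G : V ≃ₗ[ℂ] ∀ i, ℂ[X] ⧸ Ideal.span {(X - C (root i)) ^ e i} :=
    (Module.AEval'.of φ).trans (F.restrictScalars ℂ)
  have hG : ∀ v, G (φ v) = (X : ℂ[X]) • G v := fun v => by
    change F (Module.AEval'.of φ (φ v)) = (X : ℂ[X]) • F (Module.AEval'.of φ v)
    rw [← Module.AEval'.X_smul_of, map_smul]
  obtain ⟨μ, hμ⟩ : ∃ μ : κ → ℂ, Function.Injective μ :=
    ⟨fun i => ((Fintype.equivFin κ i : ℕ) : ℂ), fun i j h => by
      simpa [Fin.val_inj] using h⟩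
  set z : ∀ i, ℂ[X] ⧸ Ideal.span {(X - C (root i)) ^ e i} :=
    fun i => Ideal.Quotient.mk _ (X + C (μ i - root i)) with hz
  have hsurj : Function.Surjective (aeval (R := ℂ) z) :=
    aeval_shift_surjective root (fun i => μ i - root i) e (by simpa using hμ)
  have hρ : ∀ g v, G (aeval (LinearEquiv.conjAlgEquiv ℂ G.symm (Algebra.lmul ℂ _ z)) g v) =
      aeval z g * G v := fun g v => by
    rw [aeval_algHom_apply, aeval_algHom_apply]
    simp
  refine ⟨LinearEquiv.conjAlgEquiv ℂ G.symm (Algebra.lmul ℂ _ z), G.symm 1, ?_, fun w => ?_⟩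
  · refine LinearMap.ext fun v => G.injective ?_
    have h := fun v => hρ X v
    simp only [aeval_X] at h
    simp only [Module.End.mul_apply]
    rw [h, hG, hG, h, mul_smul_comm]
  · obtain ⟨g, hg⟩ := hsurj (G w)
    refine ⟨g, G.injective ?_⟩
    rw [hρ, hg, LinearEquiv.apply_symm_apply, mul_one]

end

/-! ### Krylov matrices -/

section Krylov

open Matrix

variable {n : ℕ} {R S : Type} [CommRing R] [CommRing S]

/-- The matrix with columns `v, A v, …, A ^ (n - 1) v`. -/
def krylov (A : Matrix (Fin n) (Fin n) R) (v : Fin n → R) : Matrix (Fin n) (Fin n) R :=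
  Matrix.of fun i k => (A ^ (k : ℕ) *ᵥ v) i

/-- The matrix `c₀ + c₁ A + ⋯ + cₙ₋₁ A ^ (n - 1)`. -/
def matrixPolynomial (A : Matrix (Fin n) (Fin n) R) (c : Fin n → R) : Matrix (Fin n) (Fin n) R :=
  ∑ k : Fin n, c k • A ^ (k : ℕ)

theorem krylov_map (f : R →+* S) (A : Matrix (Fin n) (Fin n) R) (v : Fin n → R) :
    (krylov A v).map f = krylov (A.map f) (f ∘ v) := by
  ext i k
  simp only [krylov, Matrix.map_apply, Matrix.of_apply, RingHom.map_mulVec, ← Matrix.map_pow]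

theorem det_krylov_map (f : R →+* S) (A : Matrix (Fin n) (Fin n) R) (v : Fin n → R) :
    f (krylov A v).det = (krylov (A.map f) (f ∘ v)).det := by
  rw [RingHom.map_det, RingHom.mapMatrix_apply, krylov_map]

theorem matrixPolynomial_map (f : R →+* S) (A : Matrix (Fin n) (Fin n) R) (c : Fin n → R) :
    (matrixPolynomial A c).map f = matrixPolynomial (A.map f) (f ∘ c) := by
  simp only [matrixPolynomial, ← RingHom.mapMatrix_apply, map_sum]
  refine Finset.sum_congr rfl fun k _ => ?_
  rw [← map_pow]
  ext i j
  simp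

theorem commute_matrixPolynomial (A : Matrix (Fin n) (Fin n) R) (c : Fin n → R) :
    Commute A (matrixPolynomial A c) :=
  Commute.sum_right _ _ _ fun _ _ => ((Commute.refl A).pow_right _).smul_right _

theorem krylov_mulVec (A : Matrix (Fin n) (Fin n) R) (v c : Fin n → R) :
    krylov A v *ᵥ c = matrixPolynomial A c *ᵥ v := by
  ext i
  simp only [matrixPolynomial, Matrix.sum_mulVec, Matrix.smul_mulVec, Finset.sum_apply,
    Pi.smul_apply, smul_eq_mul]
  change ∑ k, krylov A v i k * c k = ∑ k, c k * krylov A v i k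
  exact Finset.sum_congr rfl fun k _ => mul_comm (krylov A v i k) (c k)

/-- A matrix commuting with a matrix that has a cyclic vector is a polynomial in it. -/
theorem exists_eq_matrixPolynomial {A B : Matrix (Fin n) (Fin n) ℂ} {v : Fin n → ℂ}
    (h : (krylov A v).det ≠ 0) (hAB : Commute A B) : ∃ c, B = matrixPolynomial A c := by
  have hK : IsUnit (krylov A v) := (Matrix.isUnit_iff_isUnit_det _).mpr h.isUnit
  obtain ⟨c, hc⟩ := (Matrix.mulVec_surjective_iff_isUnit.mpr hK) (B *ᵥ v)
  -- Both matrices commute with `A`, so their values on the columns `A ^ k v` follow from their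
  -- common value at `v`.
  refine ⟨c, hK.mul_left_injective ?_⟩
  rw [krylov_mulVec] at hc
  have key : ∀ M : Matrix (Fin n) (Fin n) ℂ, Commute A M → ∀ i (k : Fin n),
      (M * krylov A v) i k = (A ^ (k : ℕ) *ᵥ (M *ᵥ v)) i := fun M hM i k => by
    rw [Matrix.mulVec_mulVec, (hM.pow_left k).eq, ← Matrix.mulVec_mulVec]
    rfl
  ext i k
  change (B * krylov A v) i k = (matrixPolynomial A c * krylov A v) i k
  rw [key B hAB, key _ (commute_matrixPolynomial A c), hc]

theorem exists_commute_krylov_det_ne_zero (B : Matrix (Fin n) (Fin n) ℂ) :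
    ∃ (R : Matrix (Fin n) (Fin n) ℂ) (v : Fin n → ℂ), Commute R B ∧ (krylov R v).det ≠ 0 := by
  obtain ⟨ρ, v, hρ, hv⟩ := exists_commute_cyclic (Matrix.toLinAlgEquiv' B)
  obtain ⟨R, rfl⟩ := (Matrix.toLinAlgEquiv' (R := ℂ) (n := Fin n)).surjective ρ
  refine ⟨R, v, ?_, ?_⟩
  · exact (Matrix.toLinAlgEquiv' (R := ℂ) (n := Fin n)).injective (by
      simpa only [map_mul] using hρ.eq)
  · rw [← isUnit_iff_ne_zero, ← Matrix.isUnit_iff_isUnit_det,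
      ← Matrix.mulVec_surjective_iff_isUnit]
    intro w
    obtain ⟨g, hg⟩ := hv w
    -- By Cayley–Hamilton, reduction modulo the characteristic polynomial leaves only powers below
    -- `n`, the columns of the Krylov matrix.
    rw [Polynomial.aeval_algHom_apply (Matrix.toLinAlgEquiv' (R := ℂ) (n := Fin n)),
      Matrix.aeval_eq_aeval_mod_charpoly] at hg
    refine ⟨fun k => (g %ₘ R.charpoly).coeff k, ?_⟩
    rw [krylov_mulVec, ← hg]
    change _ = Polynomial.aeval R (g %ₘ R.charpoly) *ᵥ v
    congr 1
    by_cases h0 : g %ₘ R.charpoly = 0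
    · simp [h0, matrixPolynomial]
    have hdeg : (g %ₘ R.charpoly).natDegree < n := by
      rw [Polynomial.natDegree_lt_iff_degree_lt h0]
      have := Polynomial.degree_modByMonic_lt g R.charpoly_monic
      rwa [Matrix.charpoly_degree_eq_dim, Fintype.card_fin] at this
    rw [Polynomial.aeval_eq_sum_range' hdeg, matrixPolynomial,
      Finset.sum_range]

/-- On the line through `A` and `R`, all but finitely many matrices have the cyclic vector `v` if
`R` has it. -/
theorem eventually_krylov_det_ne_zero {A R : Matrix (Fin n) (Fin n) ℂ} {v : Fin n → ℂ}
    (h : (krylov R v).det ≠ 0) :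
    ∀ᶠ t : ℂ in nhdsWithin 0 {0}ᶜ, (krylov (A + t • (R - A)) v).det ≠ 0 := by
  set Q : Polynomial ℂ := (krylov (A.map Polynomial.C +
    (Polynomial.X : Polynomial ℂ) • (R - A).map Polynomial.C) (Polynomial.C ∘ v)).det with hQ
  have hev : ∀ t, Q.eval t = (krylov (A + t • (R - A)) v).det := fun t => by
    rw [hQ, ← Polynomial.coe_evalRingHom, det_krylov_map]
    congr 2
    · ext i j
      simp
    · ext i
      simp
  -- At `t = 1` the line passes through `R`. The value `t = 0` may well be a root, hence the
  -- punctured neighbourhood.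
  have hQ0 : Q ≠ 0 := by
    rintro h0
    apply h
    have := hev 1
    rw [h0] at this
    simpa using this.symm
  have hfin : ({t | Q.IsRoot t} \ {0}).Finite := (Polynomial.finite_setOfPred_isRoot hQ0).sdiff
  have hmem : ({t | Q.IsRoot t} \ {0})ᶜ ∈ nhds (0 : ℂ) :=
    hfin.isClosed.isOpen_compl.mem_nhds (by simp)
  filter_upwards [mem_nhdsWithin_of_mem_nhds hmem, self_mem_nhdsWithin] with t ht ht0
  rw [← hev]
  exact fun h => ht ⟨h, ht0⟩

/-- The first basis vector is cyclic for the matrix shifting the basis vectors. -/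
theorem exists_krylov_det_ne_zero [NeZero n] :
    ∃ A : Matrix (Fin n) (Fin n) ℂ, (krylov A (Pi.single 0 1)).det ≠ 0 := by
  set A : Matrix (Fin n) (Fin n) ℂ := Matrix.of fun i j => if (i : ℕ) = j + 1 then 1 else 0 with hA
  have hpow : ∀ k : ℕ, ∀ i : Fin n,
      (A ^ k *ᵥ Pi.single 0 1) i = if (i : ℕ) = k then 1 else 0 := by
    intro k
    induction k with
    | zero =>
      intro i
      rw [pow_zero, Matrix.one_mulVec, Pi.single_apply]
      simp only [Fin.ext_iff, Fin.val_zero]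
    | succ k ih =>
      intro i
      rw [pow_succ', ← Matrix.mulVec_mulVec, Matrix.mulVec, dotProduct]
      simp only [ih]
      simp only [hA, Matrix.of_apply]
      by_cases hi : (i : ℕ) = k + 1
      · rw [Finset.sum_eq_single ⟨k, by omega⟩]
        · simp [hi]
        · intro j _ hj
          have : (j : ℕ) ≠ k := fun h => hj (Fin.ext h)
          simp [this]
        · simp
      · rw [if_neg hi]
        refine Finset.sum_eq_zero fun j _ => ?_
        by_cases hj : (j : ℕ) = k
        · simp [hj, hi]
        · simp [hj]
  refine ⟨A, ?_⟩
  have : krylov A (Pi.single 0 1) = 1 := by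
    ext i k
    simp [krylov, hpow, Matrix.one_apply, Fin.ext_iff]
  simp [this]

end Krylov

/-! ### The Zariski topology and the Euclidean topology -/

section Topology

open MvPolynomial

theorem isClosed_affineZariski_zeroLocus {σ : Type} (I : Ideal (MvPolynomial σ ℂ)) :
    @IsClosed _ (affineZariski σ) (zeroLocus ℂ I) := by
  let := affineZariski σ
  rw [← isOpen_compl_iff]
  exact ⟨I, compl_compl _⟩

theorem euclidean_le_affineZariski (σ : Type) :
    (Pi.topologicalSpace : TopologicalSpace (σ → ℂ)) ≤ affineZariski σ := by
  rintro S ⟨I, hI⟩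
  rw [← isClosed_compl_iff, hI]
  have : zeroLocus ℂ I = ⋂ p ∈ I, {w : σ → ℂ | aeval w p = 0} := by
    ext w
    simp [mem_zeroLocus_iff]
  rw [this]
  exact isClosed_biInter fun p _ =>
    isClosed_eq (continuous_aeval_mvPolynomial p) continuous_const

/-- The complement of a hypersurface in affine space is connected in the Euclidean topology. -/
theorem isPreconnected_eval_ne_zero {τ : Type} (D : MvPolynomial τ ℂ) :
    IsPreconnected {t : τ → ℂ | eval t D ≠ 0} := by
  refine isPreconnected_of_forall_pair fun x hx y hy => ?_
  -- `D` restricted to the complex line through `x` and `y` has finitely many zeros, and removing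
  -- them from `ℂ` leaves a connected set.
  set Q : Polynomial ℂ :=
    aeval (fun s => Polynomial.C (x s) + Polynomial.X * Polynomial.C (y s - x s)) D with hQ
  have hev : ∀ z, Q.eval z = eval (fun s => x s + z * (y s - x s)) D := fun z => by
    rw [hQ, ← Polynomial.coe_aeval_eq_eval, ← coe_aeval_eq_eval, RingHom.coe_coe,
      ← AlgHom.comp_apply, comp_aeval]
    congr 2
    ext s
    simp
  have hQ0 : Q ≠ 0 := by
    rintro h0
    apply hx
    have := hev 0
    rw [h0] at this
    simpa using this.symm
  refine ⟨(fun (z : ℂ) (s : τ) => x s + z * (y s - x s)) '' {z | Q.IsRoot z}ᶜ, ?_, ?_, ?_, ?_⟩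
  · rintro _ ⟨z, hz, rfl⟩
    simp only [Set.mem_ofPred_eq, ← hev]
    exact hz
  · exact ⟨0, fun h => hx (by simpa [hev] using h), by simp⟩
  · exact ⟨1, fun h => hy (by simpa [hev] using h), by simp⟩
  · refine IsPreconnected.image ?_ _ (by fun_prop)
    exact ((Polynomial.finite_setOfPred_isRoot hQ0).countable.isPathConnected_compl_of_one_lt_rank
      (by simp [Complex.rank_real_complex])).isConnected.isPreconnected

end Topology

/-! ### Transvections and unipotent matrices -/

section Transvection

open Matrix

/-- With `E` the matrix unit at `(s', s)`, every term of the expanded product has trace zero or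
cancels, except `N E N E`, whose trace is `(N s s')²`. Nilpotency makes the total trace zero. -/
theorem apply_eq_zero_of_isNilpotent_mul_conj_transvection {ι : Type} [Fintype ι] [DecidableEq ι]
    {N : Matrix ι ι ℂ} (hN : IsNilpotent N) {s s' : ι} (hs : s ≠ s')
    (h : IsNilpotent ((1 + N) * (transvection s' s 1 * (1 + N) * transvection s' s (-1)) - 1)) :
    N s s' = 0 := by
  set E : Matrix ι ι ℂ := single s' s 1 with hE
  have hEE : E * E = 0 := by simp [hE, single_mul_single_of_ne, hs]
  have h1 : transvection s' s (1 : ℂ) = 1 + E := rfl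
  have h2 : transvection s' s (-1 : ℂ) = 1 - E := by
    rw [transvection, sub_eq_add_neg, hE]
    congr 1
    ext i j
    simp [single_apply, apply_ite]
  have tr : ∀ {M : Matrix ι ι ℂ}, IsNilpotent M → M.trace = 0 := fun hM =>
    (isNilpotent_trace_of_isNilpotent hM).eq_zero
  have key : (1 + N) * ((1 + E) * (1 + N) * (1 - E)) - 1 =
      N + (N + (E * N - N * E) - E * N * E) + (N * N + (N * E * N - N * N * E) - N * E * (N * E))
        - (1 + N) * (E * E) := by
    noncomm_ring
  have h3 := tr h
  rw [h1, h2, key, hEE] at h3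
  simp only [mul_zero, sub_zero, trace_add, trace_sub, tr hN, zero_add] at h3
  have e1 : (E * N * E).trace = 0 := by
    rw [trace_mul_comm, ← mul_assoc, hEE, zero_mul, trace_zero]
  have e2 : (N * E * N).trace = (N * N * E).trace := by
    rw [trace_mul_comm, mul_assoc]
  have e3 : (N * N).trace = 0 := tr (Commute.isNilpotent_mul_left (Commute.refl N) hN)
  have e4 : (N * E * (N * E)).trace = N s s' * N s s' := by
    have : E * N * E = single s' s (N s s') := by simp [hE, single_mul_mul_single]
    rw [mul_assoc, ← mul_assoc E N E, this, trace_mul_single, MulOpposite.smul_eq_mul_unop,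
      MulOpposite.unop_op]
  rw [e1, e2, e3, e4, trace_mul_comm E N] at h3
  simpa using h3

theorem eq_zero_of_isNilpotent_of_apply_eq_zero {ι : Type} [Fintype ι] [DecidableEq ι]
    {N : Matrix ι ι ℂ} (hN : IsNilpotent N) (h : ∀ s s', s ≠ s' → N s s' = 0) : N = 0 := by
  have hd : N = diagonal fun s => N s s := by
    ext s s'
    by_cases hs : s = s'
    · simp [hs]
    · simp [hs, h s s' hs]
  obtain ⟨k, hk⟩ := hN
  rw [hd, diagonal_pow] at hk
  rw [hd]
  ext s s'
  have := congrFun (congrFun hk s) s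
  by_cases hs : s = s'
  · subst hs
    simp only [diagonal_apply_eq, Pi.pow_apply, Matrix.zero_apply] at this ⊢
    exact eq_zero_of_pow_eq_zero this
  · simp [hs]

end Transvection

/-! ### The group `GL_n^a × 𝔾_m^b` as a group of block diagonal matrices -/

section BlockMatrix

open Matrix

variable {n a b : ℕ} {R S : Type} [CommRing R] [CommRing S]

/-- The row and column indices of the matrices in `GL_n^a × 𝔾_m^b`. -/
abbrev BlockIndex (n a b : ℕ) : Type := (Fin n × Fin a) ⊕ Fin b

/-- The entries of the diagonal blocks: `a` blocks of size `n` and `b` blocks of size `1`. -/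
abbrev BlockEntry (n a b : ℕ) : Type := (Fin a × Fin n × Fin n) ⊕ Fin b

/-- The position of an entry of a diagonal block in the whole matrix. -/
def blockPosition : BlockEntry n a b → BlockIndex n a b × BlockIndex n a b :=
  Sum.elim (fun x => (Sum.inl (x.2.1, x.1), Sum.inl (x.2.2, x.1)))
    (fun j => (Sum.inr j, Sum.inr j))

/-- The block to which an index belongs. -/
def blockOf : BlockIndex n a b → Fin a ⊕ Fin b := Sum.map Prod.snd id

/-- The `i`-th of the `a` blocks of size `n`. -/
def block (t : BlockEntry n a b → R) (i : Fin a) : Matrix (Fin n) (Fin n) R :=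
  Matrix.of fun k l => t (Sum.inl (i, k, l))

/-- The block diagonal matrix with given blocks. -/
def blockMatrix (t : BlockEntry n a b → R) : Matrix (BlockIndex n a b) (BlockIndex n a b) R :=
  Matrix.fromBlocks (Matrix.blockDiagonal (block t)) 0 0
    (Matrix.diagonal fun j => t (Sum.inr j))

theorem block_map (f : R →+* S) (t : BlockEntry n a b → R) (i : Fin a) :
    (block t i).map f = block (f ∘ t) i := rfl

theorem blockMatrix_map (f : R →+* S) (t : BlockEntry n a b → R) :
    (blockMatrix t).map f = blockMatrix (f ∘ t) := by
  simp only [blockMatrix, Matrix.fromBlocks_map, Matrix.blockDiagonal_map _ _ (map_zero f),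
    Matrix.diagonal_map (map_zero f), Matrix.map_zero _ (map_zero f)]
  rfl

theorem det_blockMatrix_map (f : R →+* S) (t : BlockEntry n a b → R) :
    f (blockMatrix t).det = (blockMatrix (f ∘ t)).det := by
  rw [RingHom.map_det, RingHom.mapMatrix_apply, blockMatrix_map]

theorem blockMatrix_blockPosition (t : BlockEntry n a b → R) (x : BlockEntry n a b) :
    blockMatrix t (blockPosition x).1 (blockPosition x).2 = t x := by
  rcases x with ⟨i, k, l⟩ | j <;> simp [blockMatrix, blockPosition, block]

theorem blockMatrix_apply_of_ne (t : BlockEntry n a b → R) {s s' : BlockIndex n a b}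
    (h : blockOf s ≠ blockOf s') : blockMatrix t s s' = 0 := by
  rcases s with ⟨k, i⟩ | j <;> rcases s' with ⟨l, i'⟩ | j' <;>
    simp_all [blockMatrix, blockOf, Matrix.blockDiagonal_apply]

theorem eq_blockMatrix {M : Matrix (BlockIndex n a b) (BlockIndex n a b) R}
    (h : ∀ s s', blockOf s ≠ blockOf s' → M s s' = 0) :
    M = blockMatrix fun x => M (blockPosition x).1 (blockPosition x).2 := by
  ext s s'
  by_cases hs : blockOf s = blockOf s'
  · rcases s with ⟨k, i⟩ | j <;> rcases s' with ⟨l, i'⟩ | j' <;>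
      simp_all [blockMatrix, blockOf, blockPosition, block]
  · rw [h s s' hs, blockMatrix_apply_of_ne _ hs]

theorem blockMatrix_mul_comm_iff (s t : BlockEntry n a b → R) :
    blockMatrix s * blockMatrix t = blockMatrix t * blockMatrix s ↔
      ∀ i, Commute (block s i) (block t i) := by
  have h : ∀ s t : BlockEntry n a b → R, blockMatrix s * blockMatrix t =
      Matrix.fromBlocks (Matrix.blockDiagonal fun i => block s i * block t i) 0 0
        (Matrix.diagonal fun j => s (Sum.inr j) * t (Sum.inr j)) := fun s t => by
    simp [blockMatrix, Matrix.fromBlocks_multiply, Matrix.blockDiagonal_mul]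
  rw [h s t, h t s, Matrix.fromBlocks_inj, Matrix.blockDiagonal_inj]
  simp only [mul_comm (s (Sum.inr _)), and_true]
  exact funext_iff

theorem continuous_blockMatrix :
    Continuous (blockMatrix : (BlockEntry n a b → ℂ) → Matrix _ _ ℂ) := by
  refine Continuous.matrix_fromBlocks (Continuous.matrix_blockDiagonal ?_) continuous_const
    continuous_const (Continuous.matrix_diagonal ?_)
  · exact continuous_pi fun i => continuous_matrix fun k l => continuous_apply _
  · exact continuous_pi fun j => continuous_apply _

theorem det_blockMatrix_ne_zero_iff (t : BlockEntry n a b → ℂ) :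
    (blockMatrix t).det ≠ 0 ↔ (∀ i, (block t i).det ≠ 0) ∧ ∀ j, t (Sum.inr j) ≠ 0 := by
  simp [blockMatrix, Matrix.det_fromBlocks_zero₂₁, Matrix.det_blockDiagonal, Matrix.det_diagonal,
    Finset.prod_ne_zero_iff]

theorem mem_glPowTorus_iff_blockMatrix {g : GL (BlockIndex n a b) ℂ} :
    g ∈ glPowTorus n a b ↔
      ∃ t, (g : Matrix (BlockIndex n a b) (BlockIndex n a b) ℂ) = blockMatrix t := by
  constructor
  · rintro ⟨x, rfl⟩
    refine ⟨Sum.elim (fun y => (x.1 y.1 : Matrix (Fin n) (Fin n) ℂ) y.2.1 y.2.2)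
      fun j => (x.2 j : ℂ), rfl⟩
  · rintro ⟨t, ht⟩
    have hdet : (blockMatrix t).det ≠ 0 := ht ▸ (Matrix.GeneralLinearGroup.det g).ne_zero
    obtain ⟨h1, h2⟩ := (det_blockMatrix_ne_zero_iff t).mp hdet
    refine ⟨(fun i => Matrix.GeneralLinearGroup.mkOfDetNeZero _ (h1 i),
      fun j => Units.mk0 _ (h2 j)), Units.ext ?_⟩
    rw [ht]
    rfl

theorem mem_glPowTorus_iff {g : GL (BlockIndex n a b) ℂ} :
    g ∈ glPowTorus n a b ↔ ∀ s s', blockOf s ≠ blockOf s' →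
      (g : Matrix (BlockIndex n a b) (BlockIndex n a b) ℂ) s s' = 0 := by
  rw [mem_glPowTorus_iff_blockMatrix]
  refine ⟨?_, fun h => ⟨_, eq_blockMatrix h⟩⟩
  rintro ⟨t, ht⟩ s s' hs
  rw [ht, blockMatrix_apply_of_ne _ hs]

theorem exists_mem_glPowTorus {t : BlockEntry n a b → ℂ} (ht : (blockMatrix t).det ≠ 0) :
    ∃ g ∈ glPowTorus n a b,
      (g : Matrix (BlockIndex n a b) (BlockIndex n a b) ℂ) = blockMatrix t :=
  ⟨Matrix.GeneralLinearGroup.mkOfDetNeZero _ ht, mem_glPowTorus_iff_blockMatrix.mpr ⟨t, rfl⟩, rfl⟩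

theorem blockMatrix_identity :
    blockMatrix (fun x : BlockEntry n a b =>
      (1 : Matrix (BlockIndex n a b) (BlockIndex n a b) R)
        (blockPosition x).1 (blockPosition x).2) = 1 :=
  (eq_blockMatrix fun _ _ h => Matrix.one_apply_ne fun hs => h (congrArg blockOf hs)).symm

end BlockMatrix

/-! ### `GL_n^a × 𝔾_m^b` is reductive -/

section Reductive

open MvPolynomial

variable (n a b : ℕ)

/-- The determinant of the generic block diagonal matrix. -/
def genericDet : MvPolynomial (BlockEntry n a b) ℂ := (blockMatrix X).det

variable {n a b}

theorem eval_genericDet (t : BlockEntry n a b → ℂ) :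
    eval t (genericDet n a b) = (blockMatrix t).det := by
  rw [genericDet, det_blockMatrix_map]
  congr 2
  ext x
  simp

theorem genericDet_ne_zero : genericDet n a b ≠ 0 := by
  intro h
  have := eval_genericDet (n := n) (a := a) (b := b) fun x =>
    (1 : Matrix (BlockIndex n a b) (BlockIndex n a b) ℂ) (blockPosition x).1 (blockPosition x).2
  rw [h, blockMatrix_identity] at this
  simp at this

theorem isLinearAlgebraic_glPowTorus : IsLinearAlgebraic (glPowTorus n a b) := by
  let := affineZariski (GLIndex (BlockIndex n a b))
  refine isClosed_induced_iff.mpr ⟨zeroLocus ℂ (Ideal.span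
    {p | ∃ s s', blockOf s ≠ blockOf s' ∧ p = X (Sum.inl (s, s'))}),
    isClosed_affineZariski_zeroLocus _, ?_⟩
  ext g
  rw [zeroLocus_span]
  simp only [Set.mem_preimage, SetLike.mem_coe, mem_glPowTorus_iff]
  constructor
  · intro h s s' hs
    simpa [glCoord] using h _ ⟨s, s', hs, rfl⟩
  · rintro h _ ⟨s, s', hs, rfl⟩
    simpa [glCoord] using h s s' hs

/-- The parametrization by block entries is continuous from the Euclidean to the coarser Zariski
topology, so Euclidean connectedness of its domain suffices. -/
theorem isZariskiConnected_glPowTorus : IsZariskiConnected (glPowTorus n a b) := by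
  let := glZariski (BlockIndex n a b)
  have : PreconnectedSpace {t : BlockEntry n a b → ℂ | eval t (genericDet n a b) ≠ 0} :=
    isPreconnected_iff_preconnectedSpace.mp (isPreconnected_eval_ne_zero _)
  let f : {t : BlockEntry n a b → ℂ | eval t (genericDet n a b) ≠ 0} → GL (BlockIndex n a b) ℂ :=
    fun t => Matrix.GeneralLinearGroup.mkOfDetNeZero (blockMatrix t.1)
      (eval_genericDet t.1 ▸ t.2)
  have hf : Continuous f := by
    rw [continuous_induced_rng]
    refine continuous_le_rng (euclidean_le_affineZariski _) (continuous_pi ?_)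
    have hmat : Continuous fun t : {t : BlockEntry n a b → ℂ | eval t (genericDet n a b) ≠ 0} =>
        blockMatrix t.1 := continuous_blockMatrix.comp continuous_subtype_val
    rintro (⟨s, s'⟩ | _)
    · exact hmat.matrix_elem s s'
    · exact hmat.matrix_det.inv₀ fun t => eval_genericDet t.1 ▸ t.2
  have hrange : (glPowTorus n a b : Set (GL (BlockIndex n a b) ℂ)) = Set.range f := by
    ext g
    rw [SetLike.mem_coe, mem_glPowTorus_iff_blockMatrix]
    constructor
    · rintro ⟨t, ht⟩
      refine ⟨⟨t, ?_⟩, Units.ext ht.symm⟩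
      rw [Set.mem_ofPred_eq, eval_genericDet, ← ht]
      exact (Matrix.GeneralLinearGroup.det g).ne_zero
    · rintro ⟨t, rfl⟩
      exact ⟨t.1, rfl⟩
  refine ⟨⟨1, one_mem _⟩, ?_⟩
  rw [hrange]
  exact isPreconnected_range hf

theorem eq_bot_of_normal_of_isUnipotentGroup {U : Subgroup (GL (BlockIndex n a b) ℂ)}
    (hU : U ≤ glPowTorus n a b) (hnormal : (U.subgroupOf (glPowTorus n a b)).Normal)
    (hunip : IsUnipotentGroup U) : U = ⊥ := by
  refine (Subgroup.eq_bot_iff_forall U).mpr fun u hu => Units.ext ?_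
  set N : Matrix (BlockIndex n a b) (BlockIndex n a b) ℂ := u - 1 with hN
  have hu1 : (u : Matrix (BlockIndex n a b) (BlockIndex n a b) ℂ) = 1 + N := by simp [hN]
  suffices N = 0 by simpa [this] using hu1
  refine eq_zero_of_isNilpotent_of_apply_eq_zero (hunip u hu) fun s s' hs => ?_
  by_cases hblock : blockOf s = blockOf s'
  · refine apply_eq_zero_of_isNilpotent_mul_conj_transvection (hunip u hu) hs ?_
    -- As `s` and `s'` share a block, this transvection lies in the group, so conjugation by it
    -- preserves `U`.
    set T : GL (BlockIndex n a b) ℂ := ⟨Matrix.transvection s' s 1, Matrix.transvection s' s (-1),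
      by rw [Matrix.transvection_mul_transvection_same _ _ hs.symm]; simp,
      by rw [Matrix.transvection_mul_transvection_same _ _ hs.symm]; simp⟩ with hT
    have hTG : T ∈ glPowTorus n a b := mem_glPowTorus_iff.mpr fun r r' hr => by
      have h1 : r ≠ r' := fun h => hr (congrArg blockOf h)
      have h2 : ¬(s' = r ∧ s = r') := by
        rintro ⟨rfl, rfl⟩
        exact hr hblock.symm
      simp [hT, Matrix.transvection, h1, h2]
    have hconj : T * u * T⁻¹ ∈ U :=
      hnormal.conj_mem ⟨u, hU hu⟩ hu ⟨T, hTG⟩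
    rw [← hu1]
    exact hunip _ (mul_mem hu hconj)
  · rw [hN, Matrix.sub_apply, mem_glPowTorus_iff.mp (hU hu) s s' hblock, Matrix.one_apply_ne hs,
      sub_zero]

theorem isReductive_glPowTorus : IsReductive (glPowTorus n a b) where
  linearAlgebraic := isLinearAlgebraic_glPowTorus
  connected := isZariskiConnected_glPowTorus
  unipotentRadical _ hU hnormal _ _ hunip := eq_bot_of_normal_of_isUnipotentGroup hU hnormal hunip

end Reductive

/-! ### Dimension of `GL_n^a × 𝔾_m^b` -/

section Dimension

open MvPolynomial

variable {n a b : ℕ}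

theorem groupDim_glPowTorus : groupDim (glPowTorus n a b) = a * n ^ 2 + b := by
  have h := affineDim_eq_card (glCoord '' (glPowTorus n a b : Set (GL (BlockIndex n a b) ℂ)))
    (genericDet n a b) genericDet_ne_zero
    (Sum.elim (fun s => genericDet n a b * blockMatrix X s.1 s.2) fun _ => 1) ?_
    (Sum.inl ∘ blockPosition) ?_
  · rw [groupDim, h]
    simp [sq]
  · rintro _ ⟨g, hg, rfl⟩
    obtain ⟨t, ht⟩ := mem_glPowTorus_iff_blockMatrix.mp hg
    have hdet : (blockMatrix t).det ≠ 0 := ht ▸ (Matrix.GeneralLinearGroup.det g).ne_zero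
    refine subset_closure ⟨t, by rwa [eval_genericDet], ?_⟩
    rintro (⟨s, s'⟩ | _)
    · have : eval t (blockMatrix X s s') = blockMatrix t s s' := by
        rw [← Matrix.map_apply (f := eval t), blockMatrix_map, eval_comp_X]
      simp [glCoord, ht, this]
    · simp [glCoord, ht, eval_genericDet, hdet]
  · intro P hP
    refine mvPolynomial_eq_zero_of_eval_eq_zero genericDet_ne_zero fun t ht => ?_
    rw [eval_genericDet] at ht
    obtain ⟨g, hg, hgt⟩ := exists_mem_glPowTorus ht
    have := hP _ ⟨g, hg, rfl⟩
    rwa [show glCoord g ∘ Sum.inl ∘ blockPosition = t by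
      ext x
      simp [glCoord, hgt, blockMatrix_blockPosition]] at this

end Dimension

/-! ### Dimension of the variety of commuting pairs -/

section Commuting

open MvPolynomial

variable {n a b : ℕ} {R S : Type} [CommRing R] [CommRing S]

/-- The parameters of a generic pair of commuting block diagonal matrices: the entries of the
first one, and the coefficients of the polynomials that express the `n × n` blocks of the second
one, together with its `1 × 1` blocks. -/
abbrev PairParam (n a b : ℕ) : Type := BlockEntry n a b ⊕ ((Fin a × Fin n) ⊕ Fin b)

/-- The entries of the second matrix of the pair with given parameters. -/
def partner (t : PairParam n a b → R) : BlockEntry n a b → R :=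
  Sum.elim
    (fun x => matrixPolynomial (block (t ∘ Sum.inl) x.1)
      (fun m => t (Sum.inr (Sum.inl (x.1, m)))) x.2.1 x.2.2)
    (fun j => t (Sum.inr (Sum.inr j)))

theorem block_partner (t : PairParam n a b → R) (i : Fin a) :
    block (partner t) i = matrixPolynomial (block (t ∘ Sum.inl) i)
      (fun m => t (Sum.inr (Sum.inl (i, m)))) := rfl

theorem partner_map (f : R →+* S) (t : PairParam n a b → R) :
    f ∘ partner t = partner (f ∘ t) := by
  ext x
  rcases x with ⟨i, k, l⟩ | j
  · exact congrFun (congrFun (matrixPolynomial_map f (block (t ∘ Sum.inl) i)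
      (fun m => t (Sum.inr (Sum.inl (i, m))))) k) l
  · rfl

theorem blockMatrix_mul_partner (t : PairParam n a b → R) :
    blockMatrix (t ∘ Sum.inl) * blockMatrix (partner t) =
      blockMatrix (partner t) * blockMatrix (t ∘ Sum.inl) :=
  (blockMatrix_mul_comm_iff _ _).mpr fun i => by
    rw [block_partner]
    exact commute_matrixPolynomial _ _

theorem eval_det_first (t : PairParam n a b → ℂ) :
    eval t (blockMatrix ((X : PairParam n a b → MvPolynomial _ ℂ) ∘ Sum.inl)).det =
      (blockMatrix (t ∘ Sum.inl)).det := by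
  rw [det_blockMatrix_map, eval_comp_X_comp]

theorem eval_det_second (t : PairParam n a b → ℂ) :
    eval t (blockMatrix (partner (X : PairParam n a b → MvPolynomial _ ℂ))).det =
      (blockMatrix (partner t)).det := by
  rw [det_blockMatrix_map, partner_map, eval_comp_X]

variable (n a b) in
/-- The product of the determinants of the generic pair of commuting block diagonal matrices. -/
def pairDet : MvPolynomial (PairParam n a b) ℂ :=
  (blockMatrix (X ∘ Sum.inl)).det * (blockMatrix (partner X)).det

theorem eval_pairDet (t : PairParam n a b → ℂ) :
    eval t (pairDet n a b) = (blockMatrix (t ∘ Sum.inl)).det * (blockMatrix (partner t)).det := by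
  rw [pairDet, map_mul, eval_det_first, eval_det_second]

variable (n a b) in
/-- The coordinates of the generic pair, multiplied by `pairDet`. -/
def pairCoordNumerator : GLIndex (BlockIndex n a b) ⊕ GLIndex (BlockIndex n a b) →
    MvPolynomial (PairParam n a b) ℂ :=
  Sum.elim
    (Sum.elim (fun s => pairDet n a b * blockMatrix (X ∘ Sum.inl) s.1 s.2)
      fun _ => (blockMatrix (partner X)).det)
    (Sum.elim (fun s => pairDet n a b * blockMatrix (partner X) s.1 s.2)
      fun _ => (blockMatrix (X ∘ Sum.inl)).det)

/-- The coordinates of a matrix in the affine space containing the general linear group. -/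
def matrixCoord {ι : Type} [Fintype ι] [DecidableEq ι] (M : Matrix ι ι ℂ) : GLIndex ι → ℂ :=
  Sum.elim (fun s => M s.1 s.2) fun _ => M.det⁻¹

theorem pairDet_mul_matrixCoord (t : PairParam n a b → ℂ) (ht : eval t (pairDet n a b) ≠ 0)
    (s : GLIndex (BlockIndex n a b) ⊕ GLIndex (BlockIndex n a b)) :
    eval t (pairDet n a b) * Sum.elim (matrixCoord (blockMatrix (t ∘ Sum.inl)))
      (matrixCoord (blockMatrix (partner t))) s = eval t (pairCoordNumerator n a b s) := by
  have h := ht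
  rw [eval_pairDet] at h
  obtain ⟨h1, h2⟩ := mul_ne_zero_iff.mp h
  rcases s with (⟨s, s'⟩ | _) | (⟨s, s'⟩ | _)
  · have : eval t (blockMatrix (X ∘ Sum.inl) s s') = blockMatrix (t ∘ Sum.inl) s s' := by
      rw [← Matrix.map_apply (f := eval t), blockMatrix_map, eval_comp_X_comp]
    simp [pairCoordNumerator, matrixCoord, this]
  · simp only [pairCoordNumerator, matrixCoord, Sum.elim_inl, Sum.elim_inr, eval_pairDet,
      eval_det_second]
    field_simp
  · have : eval t (blockMatrix (partner X) s s') = blockMatrix (partner t) s s' := by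
      rw [← Matrix.map_apply (f := eval t), blockMatrix_map, partner_map, eval_comp_X]
    simp [pairCoordNumerator, matrixCoord, this]
  · simp only [pairCoordNumerator, matrixCoord, Sum.elim_inr, eval_pairDet, eval_det_first]
    field_simp

theorem pairDet_ne_zero [NeZero n] : pairDet n a b ≠ 0 := by
  -- The pair `(1, 1)`: each block of the second matrix is the constant polynomial `1` in that of
  -- the first.
  let t : PairParam n a b → ℂ := Sum.elim
    (fun x => (1 : Matrix (BlockIndex n a b) (BlockIndex n a b) ℂ)
      (blockPosition x).1 (blockPosition x).2)
    (Sum.elim (fun x => if x.2 = 0 then 1 else 0) fun _ => 1)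
  intro h
  have ht := eval_pairDet t
  have h1 : blockMatrix (t ∘ Sum.inl) = 1 := blockMatrix_identity
  have h2 : (blockMatrix (partner t)).det ≠ 0 := by
    rw [det_blockMatrix_ne_zero_iff]
    refine ⟨fun i => ?_, fun j => by simp [partner, t]⟩
    have : block (partner t) i = 1 := by
      rw [block_partner, matrixPolynomial, Finset.sum_eq_single 0]
      · simp [t]
      · intro k _ hk
        simp [t, hk]
      · simp
    simp [this]
  rw [h, h1, map_zero, Matrix.det_one, one_mul] at ht
  exact h2 ht.symm

/-- Commuting pairs are limits of pairs in which the blocks of the second matrix are polynomials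
in the blocks of the first one. -/
theorem mem_closure_of_mem_commutingPairs {x : GL (BlockIndex n a b) ℂ × GL (BlockIndex n a b) ℂ}
    (hx : x ∈ commutingPairs (glPowTorus n a b)) :
    glPairCoord x ∈ closure {w | ∃ t, eval t (pairDet n a b) ≠ 0 ∧
      ∀ s, eval t (pairDet n a b) * w s = eval t (pairCoordNumerator n a b s)} := by
  obtain ⟨g, h⟩ := x
  obtain ⟨hg, hh, hgh⟩ := hx
  obtain ⟨p, hp⟩ := mem_glPowTorus_iff_blockMatrix.mp hg
  obtain ⟨q, hq⟩ := mem_glPowTorus_iff_blockMatrix.mp hh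
  have hpdet : (blockMatrix p).det ≠ 0 := hp ▸ (Matrix.GeneralLinearGroup.det g).ne_zero
  have hqdet : (blockMatrix q).det ≠ 0 := hq ▸ (Matrix.GeneralLinearGroup.det h).ne_zero
  have hcomm : ∀ i, Commute (block p i) (block q i) := by
    rw [← blockMatrix_mul_comm_iff, ← hp, ← hq]
    exact congrArg Units.val hgh
  choose R v hR hv using fun i => exists_commute_krylov_det_ne_zero (block q i)
  let line : ℂ → BlockEntry n a b → ℂ := fun z => Sum.elim
    (fun x => (block p x.1 + z • (R x.1 - block p x.1)) x.2.1 x.2.2) fun j => p (Sum.inr j)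
  have hline : Continuous line := by
    refine continuous_pi ?_
    rintro (⟨i, k, l⟩ | j)
    · change Continuous fun z : ℂ => block p i k l + z * (R i k l - block p i k l)
      fun_prop
    · exact continuous_const
  have hline0 : line 0 = p := by
    ext x
    rcases x with ⟨i, k, l⟩ | j <;> simp [line, block]
  have hmat : Continuous fun z => blockMatrix (line z) := continuous_blockMatrix.comp hline
  have hdet : ∀ᶠ z in nhds (0 : ℂ), (blockMatrix (line z)).det ≠ 0 :=
    hmat.matrix_det.continuousAt.eventually_ne (by rwa [hline0])
  refine mem_closure_of_tendsto (b := nhdsWithin 0 {0}ᶜ)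
    (f := fun z : ℂ => Sum.elim (matrixCoord (blockMatrix (line z))) (glCoord h)) ?_ ?_
  · refine Filter.Tendsto.mono_left ?_ nhdsWithin_le_nhds
    rw [tendsto_pi_nhds]
    rintro ((⟨s, s'⟩ | _) | s)
    · have := (hmat.matrix_elem s s').tendsto 0
      rw [hline0, ← hp] at this
      exact this
    · have := (hmat.matrix_det.tendsto 0).inv₀ (by rwa [hline0])
      rw [hline0, ← hp] at this
      exact this
    · exact tendsto_const_nhds
  · filter_upwards [mem_nhdsWithin_of_mem_nhds hdet, Filter.eventually_all.mpr fun i =>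
      eventually_krylov_det_ne_zero (A := block p i) (hv i)] with z hz hk
    -- The whole line lies in the centralizer of `block q i`, so only the first matrix has to be
    -- perturbed.
    have hc : ∀ i, ∃ c, block q i = matrixPolynomial (block (line z) i) c := fun i =>
      exists_eq_matrixPolynomial (hk i)
        ((hcomm i).add_left (((hR i).sub_left (hcomm i)).smul_left z))
    choose c hc using hc
    let t : PairParam n a b → ℂ := Sum.elim (line z)
      (Sum.elim (fun x => c x.1 x.2) fun j => q (Sum.inr j))
    have ht : partner t = q := by
      ext x
      rcases x with ⟨i, k, l⟩ | j
      · exact (congrFun (congrFun (hc i) k) l).symm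
      · rfl
    have ht0 : eval t (pairDet n a b) ≠ 0 := by
      rw [eval_pairDet, ht]
      exact mul_ne_zero hz hqdet
    refine ⟨t, ht0, fun s => ?_⟩
    rw [← pairDet_mul_matrixCoord t ht0, ht, ← hq]
    rfl

/-- The entries of the first matrix of the pair, and those of the second one that lie in the
first columns of the diagonal blocks. -/
def pairCoordinate [NeZero n] :
    PairParam n a b → GLIndex (BlockIndex n a b) ⊕ GLIndex (BlockIndex n a b) :=
  Sum.elim (fun x => Sum.inl (Sum.inl (blockPosition x)))
    (Sum.elim (fun x => Sum.inr (Sum.inl (blockPosition (Sum.inl (x.1, x.2, 0)))))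
      fun j => Sum.inr (Sum.inl (blockPosition (Sum.inr j))))

/-- The values of the coordinates `pairCoordinate` at the pair with given parameters. -/
def pairValue [NeZero n] (t : PairParam n a b → R) : PairParam n a b → R :=
  Sum.elim (t ∘ Sum.inl)
    (Sum.elim (fun x => partner t (Sum.inl (x.1, x.2, 0))) fun j => partner t (Sum.inr j))

theorem pairValue_map [NeZero n] (f : R →+* S) (t : PairParam n a b → R) :
    f ∘ pairValue t = pairValue (f ∘ t) := by
  ext x
  rcases x with x | x | j
  · rfl
  · exact congrFun (partner_map f t) (Sum.inl (x.1, x.2, 0))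
  · rfl

variable (n a b) in
/-- The product of the Krylov determinants of the blocks of the first matrix. -/
def krylovDet [NeZero n] : MvPolynomial (PairParam n a b) ℂ :=
  ∏ i, (krylov (block (X ∘ Sum.inl) i) (Pi.single 0 1)).det

theorem eval_krylovDet [NeZero n] (t : PairParam n a b → ℂ) :
    eval t (krylovDet n a b) = ∏ i, (krylov (block (t ∘ Sum.inl) i) (Pi.single 0 1)).det := by
  rw [krylovDet, map_prod]
  refine Finset.prod_congr rfl fun i _ => ?_
  rw [det_krylov_map, block_map, eval_comp_X_comp]
  congr 2
  ext k
  simp [Pi.single_apply, apply_ite]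

theorem krylovDet_ne_zero [NeZero n] : krylovDet n a b ≠ 0 := by
  obtain ⟨A, hA⟩ := exists_krylov_det_ne_zero (n := n)
  intro h
  have := eval_krylovDet (n := n) (a := a) (b := b)
    (Sum.elim (Sum.elim (fun x => A x.2.1 x.2.2) 0) 0)
  rw [h, map_zero] at this
  exact Finset.prod_ne_zero_iff.mpr (fun i _ => hA) this.symm

/-- The first column of `c(A)` is the Krylov matrix of `A` at `e₀` applied to `c`, so the
coefficients come from an invertible linear system. -/
theorem exists_pairValue_eq [NeZero n] {t : PairParam n a b → ℂ}
    (ht : eval t (krylovDet n a b) ≠ 0) : ∃ u, pairValue u = t := by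
  rw [eval_krylovDet, Finset.prod_ne_zero_iff] at ht
  have hc : ∀ i, ∃ c, Matrix.mulVec (krylov (block (t ∘ Sum.inl) i) (Pi.single 0 1)) c =
      fun k => t (Sum.inr (Sum.inl (i, k))) := fun i =>
    Matrix.mulVec_surjective_iff_isUnit.mpr ((Matrix.isUnit_iff_isUnit_det _).mpr
      (ht i (Finset.mem_univ i)).isUnit) _
  choose c hc using hc
  refine ⟨Sum.elim (t ∘ Sum.inl) (Sum.elim (fun x => c x.1 x.2) (t ∘ Sum.inr ∘ Sum.inr)), ?_⟩
  ext x
  rcases x with x | ⟨i, k⟩ | j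
  · rfl
  · have := congrFun (hc i) k
    rw [krylov_mulVec] at this
    simpa [pairValue, partner] using this
  · rfl

theorem eq_zero_of_eval_commutingPairs [NeZero n] {P : MvPolynomial (PairParam n a b) ℂ}
    (hP : ∀ v ∈ glPairCoord '' commutingPairs (glPowTorus n a b),
      eval (v ∘ pairCoordinate) P = 0) : P = 0 := by
  have hev : ∀ u, eval u (bind₁ (pairValue X) P) = eval (pairValue u) P := fun u => by
    rw [← eval_comp_X u, ← pairValue_map, eval_comp_X]
    simp only [← coe_aeval_eq_eval, RingHom.coe_coe]
    rw [aeval_bind₁]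
    rfl
  -- The pulled-back polynomial must vanish identically, because the preimages `u` used below may
  -- give singular matrices.
  have hzero : bind₁ (pairValue X) P = 0 := by
    refine mvPolynomial_eq_zero_of_eval_eq_zero (pairDet_ne_zero (n := n) (a := a) (b := b))
      fun u hu => ?_
    rw [eval_pairDet] at hu
    obtain ⟨g, hg, hgu⟩ := exists_mem_glPowTorus (left_ne_zero_of_mul hu)
    obtain ⟨h, hh, hhu⟩ := exists_mem_glPowTorus (right_ne_zero_of_mul hu)
    have hgh : g * h = h * g := Units.ext (by
      rw [Units.val_mul, Units.val_mul, hgu, hhu, blockMatrix_mul_partner])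
    have := hP _ ⟨(g, h), ⟨hg, hh, hgh⟩, rfl⟩
    rw [hev]
    rwa [show glPairCoord (g, h) ∘ pairCoordinate = pairValue u by
      ext x
      rcases x with x | x | j <;> simp [pairValue, pairCoordinate, glPairCoord, glCoord, hgu, hhu,
        blockMatrix_blockPosition]] at this
  refine mvPolynomial_eq_zero_of_eval_eq_zero (krylovDet_ne_zero (n := n) (a := a) (b := b))
    fun t ht => ?_
  obtain ⟨u, rfl⟩ := exists_pairValue_eq ht
  rw [← hev, hzero, map_zero]

theorem affineDim_commutingPairs [NeZero n] :
    affineDim (glPairCoord '' commutingPairs (glPowTorus n a b)) = a * (n ^ 2 + n) + 2 * b := by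
  rw [affineDim_eq_card _ (pairDet n a b) pairDet_ne_zero (pairCoordNumerator n a b) ?_
    pairCoordinate fun _ => eq_zero_of_eval_commutingPairs]
  · simp
    ring
  · rintro _ ⟨x, hx, rfl⟩
    exact mem_closure_of_mem_commutingPairs hx

end Commuting

end

/-! ### Commuting probabilities -/

theorem exists_two_le_and_div_le {x : ℚ} (hx : 1 / 2 < x) :
    ∃ n : ℕ, 2 ≤ n ∧ ((n : ℚ) + 1) / (2 * n) ≤ x := by
  -- The target inequality says `1/n ≤ 2x - 1`.
  obtain ⟨m, hm⟩ := exists_nat_gt (1 / (2 * x - 1))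
  refine ⟨m + 2, by omega, ?_⟩
  have h1 : 0 < 2 * x - 1 := by linarith
  rw [div_lt_iff₀ h1] at hm
  rw [div_le_iff₀ (by positivity)]
  push_cast
  nlinarith

theorem exists_torus_rank {p q n : ℕ} (hq : 0 < q) (hn : 1 ≤ n)
    (h : ((n : ℚ) + 1) / (2 * n) ≤ (p : ℚ) / q) :
    ∃ b : ℕ, 2 * (b : ℤ) = 2 * n ^ 2 * p - n ^ 2 * q - n * q := by
  have hn' : (0 : ℚ) < n := by exact_mod_cast hn
  have hq' : (0 : ℚ) < q := by exact_mod_cast hq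
  rw [div_le_div_iff₀ (by positivity) hq'] at h
  have h' : ((n : ℤ) + 1) * q ≤ p * (2 * n) := by exact_mod_cast h
  obtain ⟨m, hm⟩ := Nat.even_mul_succ_self n
  have hm' : (n : ℤ) * (n + 1) = m + m := by exact_mod_cast hm
  -- With `m = n(n+1)/2` this is `b` itself; it is the hypothesis `(n+1)q ≤ 2np` multiplied by
  -- `n/2`.
  have hnonneg : 0 ≤ (n : ℤ) ^ 2 * p - m * q := by nlinarith
  obtain ⟨b, hb⟩ := Int.eq_ofNat_of_zero_le hnonneg
  exact ⟨b, by rw [← hb]; linear_combination (q : ℤ) * hm'⟩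

theorem algCommProb_glPowTorus {p q n b : ℕ} (hq : 0 < q) (hn : 1 ≤ n) (hpq : p ≤ q)
    (h : ((n : ℚ) + 1) / (2 * n) ≤ (p : ℚ) / q)
    (hb : 2 * (b : ℤ) = 2 * n ^ 2 * p - n ^ 2 * q - n * q) :
    algCommProb (glPowTorus n (q - p) b) = (p : ℚ) / q := by
  have : NeZero n := ⟨by omega⟩
  have hq' : (0 : ℚ) < q := by exact_mod_cast hq
  have hb' : 2 * (b : ℚ) = 2 * n ^ 2 * p - n ^ 2 * q - n * q := by exact_mod_cast hb
  rw [algCommProb, groupDim_glPowTorus, affineDim_commutingPairs]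
  have hdim : 2 * (((q - p : ℕ) * n ^ 2 + b : ℕ) : ℚ) = n * (n - 1) * q := by
    push_cast [Nat.cast_sub hpq]
    linear_combination hb'
  have hcomm : (((q - p : ℕ) * (n ^ 2 + n) + 2 * b : ℕ) : ℚ) = n * (n - 1) * p := by
    push_cast [Nat.cast_sub hpq]
    linear_combination hb'
  rw [hdim, hcomm]
  -- For `n = 1` the hypotheses force `p = q` and `b = 0`: the group is trivial and the convention
  -- for dimension `0` gives `1`.
  rcases hn.eq_or_lt with rfl | hn2
  · have h1 : (q : ℚ) ≤ p := by
      rw [le_div_iff₀ hq'] at h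
      norm_num at h
      exact_mod_cast h
    have h2 : p = q := le_antisymm hpq (by exact_mod_cast h1)
    subst h2
    rw [if_pos (by
      have : (((p - p : ℕ) * 1 ^ 2 + b : ℕ) : ℚ) = 0 := by
        norm_num at hdim ⊢
        exact hdim
      exact_mod_cast this), div_self hq'.ne']
  · have hn3 : (1 : ℚ) < n := by exact_mod_cast hn2
    have hpos : (0 : ℚ) < n * (n - 1) := mul_pos (by linarith) (by linarith)
    rw [if_neg fun h0 => (mul_pos hpos hq').ne' (by rw [← hdim, h0]; simp)]
    exact mul_div_mul_left _ _ hpos.ne'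

theorem mainTheorem4 :
    (∀ r : ℚ, 1 / 2 < r → r ≤ 1 →
      ∃ (ι : Type) (_ : Fintype ι) (_ : DecidableEq ι) (G : Subgroup (GL ι ℂ)),
        IsReductive G ∧ algCommProb G = r) ∧
    (∀ p q : ℕ, 0 < q → (1 / 2 : ℚ) < (p : ℚ) / q → (p : ℚ) / q ≤ 1 →
      (∃ n : ℕ, 2 ≤ n ∧ ((n : ℚ) + 1) / (2 * n) ≤ (p : ℚ) / q) ∧
      (∀ n : ℕ, 1 ≤ n → ((n : ℚ) + 1) / (2 * n) ≤ (p : ℚ) / q →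
        ∃ b : ℕ, 2 * (b : ℤ) = 2 * n ^ 2 * p - n ^ 2 * q - n * q ∧
          IsReductive (glPowTorus n (q - p) b) ∧
          algCommProb (glPowTorus n (q - p) b) = (p : ℚ) / q)) := by
  have main : ∀ p q : ℕ, 0 < q → (p : ℚ) / q ≤ 1 → ∀ n : ℕ, 1 ≤ n →
      ((n : ℚ) + 1) / (2 * n) ≤ (p : ℚ) / q →
        ∃ b : ℕ, 2 * (b : ℤ) = 2 * n ^ 2 * p - n ^ 2 * q - n * q ∧
          IsReductive (glPowTorus n (q - p) b) ∧
          algCommProb (glPowTorus n (q - p) b) = (p : ℚ) / q := by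
    intro p q hq h1 n hn h
    have hpq : p ≤ q := by
      rw [div_le_one (by exact_mod_cast hq)] at h1
      exact_mod_cast h1
    obtain ⟨b, hb⟩ := exists_torus_rank hq hn h
    exact ⟨b, hb, isReductive_glPowTorus, algCommProb_glPowTorus hq hn hpq h hb⟩
  refine ⟨fun r hr hr1 => ?_, fun p q hq h2 h1 => ⟨exists_two_le_and_div_le h2, main p q hq h1⟩⟩
  have hnum : 0 ≤ r.num := Rat.num_nonneg.mpr (by linarith)
  have hr' : (r.num.toNat : ℚ) / r.den = r := by
    have : ((r.num.toNat : ℤ) : ℚ) = r.num := by rw [Int.toNat_of_nonneg hnum]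
    rw [Int.cast_natCast] at this
    rw [this, Rat.num_div_den]
  obtain ⟨n, hn, h⟩ := exists_two_le_and_div_le hr
  obtain ⟨b, -, hred, hprob⟩ := main r.num.toNat r.den r.pos (by rwa [hr']) n (by omega)
    (by rwa [hr'])
  exact ⟨_, inferInstance, inferInstance, _, hred, hprob.trans hr'⟩
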